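/- Let $\Delta=\{z\in\mathbb C:|z|<1\}$ and let $\mathcal A$ be the class of analytic functions $f$ on $\Delta$ with $f(0)=0$ and $f'(0)=1$. For analytic $g,h$ on $\Delta$ write $g\prec h$ if $g=h\circ\omega$ on $\Delta$ for some analytic $\omega:\Delta\to\Delta$ with $\omega(0)=0$. For $0\le\alpha<1$ let $\mathcal{BS}(\alpha)$ be the class of all $f\in\mathcal A$ with $f(z)\neq0$ for $z\in\Delta\setminus\{0\}$ and $$\frac{zf'(z)}{f(z)}-1\prec\frac{z}{1-\alpha z^2},$$ where the left-hand side takes the value $0$ at $z=0$. Below, $\arg$ and powers denote principal values. **Theorem.** Let $0<\alpha\le 2-\sqrt3$ and $0<r<1$. Then for every $f\in\mathcal{BS}(\alpha)$ and every $z$ with $|z|=r$, $$\left|\arg\frac{f(z)}{z}\right|\le \max_{|\zeta|=r}\ \arg\left(\left(\frac{1+\sqrt\alpha\,\zeta}{1-\sqrt\alpha\,\zeta}\right)^{\frac1{2\sqrt\alpha}}\right),$$ where the maximum is attained. The inequality is sharp: the function $$\hat f(z)=z\left(\frac{1+\sqrt\alpha\,z}{1-\sqrt\alpha\,z}\right)^{\frac1{2\sqrt\alpha}}$$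 belongs to $\mathcal{BS}(\alpha)$, and for every $r\in(0,1)$ equality holds for $f=\hat f$ at some $z$ with $|z|=r$. -/

import Mathlib

namespace GeomFun

/-- The class `𝒜`: analytic functions `f` on the open unit disk with `f(0) = 0`, `f'(0) = 1`.
Values outside the disk are irrelevant. -/
def classA : Set (ℂ → ℂ) :=
  {f | AnalyticOnNhd ℂ f (Metric.ball 0 1) ∧ f 0 = 0 ∧ deriv f 0 = 1}

/-- Schwarz functions: analytic self-maps of the open unit disk that fix the origin. -/
def IsSchwarz (ω : ℂ → ℂ) : Prop :=
  AnalyticOnNhd ℂ ω (Metric.ball 0 1) ∧ ω 0 = 0 ∧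
    Set.MapsTo ω (Metric.ball 0 1) (Metric.ball 0 1)

/-- Subordination `g ≺ h` in the open unit disk: `g = h ∘ ω` there, for a Schwarz function `ω`. -/
def Subordinate (g h : ℂ → ℂ) : Prop :=
  ∃ ω : ℂ → ℂ, IsSchwarz ω ∧ ∀ z ∈ Metric.ball (0 : ℂ) 1, g z = h (ω z)

/-- The function `z f'(z) / f(z) - 1`, with its removable singularity at the origin filled in
(for `f ∈ 𝒜` its limit at `0` is `0`). -/
noncomputable def starQuotient (f : ℂ → ℂ) (z : ℂ) : ℂ :=
  if z = 0 then 0 else z * deriv f z / f z - 1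

/-- The class `ℱ(ψ)`: functions `f ∈ 𝒜` with `z f'(z) / f(z) - 1 ≺ ψ(z)`; that the quotient is a
function on the whole disk means that `f` has no zero there besides the origin. -/
def classF (ψ : ℂ → ℂ) : Set (ℂ → ℂ) :=
  {f | f ∈ classA ∧ (∀ z ∈ Metric.ball (0 : ℂ) 1, z ≠ 0 → f z ≠ 0) ∧
    Subordinate (starQuotient f) ψ}

/-- The Booth lemniscate function `z / (1 - α z²)`. -/
noncomputable def booth (α : ℝ) (z : ℂ) : ℂ := z / (1 - (α : ℂ) * z ^ 2)

/-- The class `ℬ𝒮(α)`. -/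
noncomputable def classBS (α : ℝ) : Set (ℂ → ℂ) := classF (booth α)

/-- The function `((1 + √α z) / (1 - √α z)) ^ (1 / (2 √α))`, with the principal power. -/
noncomputable def boothPower (α : ℝ) (z : ℂ) : ℂ :=
  ((1 + z * (Real.sqrt α : ℂ)) / (1 - z * (Real.sqrt α : ℂ))) ^
    (((1 / (2 * Real.sqrt α) : ℝ)) : ℂ)

/-- The extremal function `z ((1 + √α z) / (1 - √α z)) ^ (1 / (2 √α))`. -/
noncomputable def fHat (α : ℝ) (z : ℂ) : ℂ := z * boothPower α z

end GeomFun

namespace GeomFun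

open Complex Metric Set

/-! With c = √α, write f(z) = z exp(g(z)); then z g'(z) is the Booth function B evaluated at a
Schwarz function. If that Schwarz function is the identity, g(z) is artanh(cz)/c, and f is the
extremal function. In general g is subordinate to artanh(cz)/c, because B is starlike. Indeed,
suppose G = tanh(cg)/c first reaches modulus 1 at z₀. Jack's lemma gives z₀G'(z₀) = kG(z₀) with k ≥
1, that is z₀g'(z₀) = kB(G(z₀)), and `booth_starlike` says that this is no value of B in the open
disk.

The Schwarz lemma then yields |tanh(cg(z))| ≤ c|z|, which passes to |tan(c Im g(z))| ≤ c|z|. Hence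
|arg(f(z)/z)| = |Im g(z)| ≤ arctan(cr)/c, with equality for the extremal function at z = ir. -/

/-! ### Starlikeness and Jack's lemma -/

/-- The Booth function is starlike: a real multiple `k ≥ 1` of one of its values on the unit circle
is not a value in the open unit disk. -/
theorem booth_starlike {c k : ℝ} (hc0 : 0 < c) (hc1 : c < 1) (hk : 1 ≤ k) {G w : ℂ}
    (hG : ‖G‖ = 1) (hw : ‖w‖ < 1)
    (h : w * (1 - (c : ℂ) ^ 2 * G ^ 2) = k * G * (1 - (c : ℂ) ^ 2 * w ^ 2)) : False := by
  have hG0 : G ≠ 0 := norm_ne_zero_iff.1 (by rw [hG]; exact one_ne_zero)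
  have hk0 : (k : ℂ) ≠ 0 := by exact_mod_cast (by linarith : k ≠ 0)
  have hw0 : w ≠ 0 := by
    rintro rfl
    simp [hG0, hk0] at h
  have hn : 0 < ‖w‖ := norm_pos_iff.2 hw0
  have hG2 : G.re ^ 2 + G.im ^ 2 = 1 := by
    have := Complex.sq_norm G
    rw [hG, Complex.normSq_apply] at this
    linarith
  have hw2 : w.re ^ 2 + w.im ^ 2 = ‖w‖ ^ 2 := by
    rw [Complex.sq_norm, Complex.normSq_apply]; ring
  -- `1 / z - c² z` at both points
  have h' : (starRingEnd ℂ) G - (c : ℂ) ^ 2 * G =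
      k * ((starRingEnd ℂ) w / (‖w‖ : ℂ) ^ 2 - (c : ℂ) ^ 2 * w) := by
    have e1 : (starRingEnd ℂ) G * G = 1 := by
      rw [mul_comm, Complex.mul_conj']; simp [hG]
    have e2 : (starRingEnd ℂ) w * w = (‖w‖ : ℂ) ^ 2 := by
      rw [mul_comm, Complex.mul_conj']
    have hn' : (‖w‖ : ℂ) ≠ 0 := by exact_mod_cast hn.ne'
    have e3 : (starRingEnd ℂ) w / (‖w‖ : ℂ) ^ 2 = 1 / w := by
      rw [← e2]
      have : (starRingEnd ℂ) w ≠ 0 := by simpa using hw0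
      field_simp
    have e4 : (starRingEnd ℂ) G = 1 / G := by
      field_simp; exact e1
    rw [e3, e4]
    field_simp
    linear_combination h
  have hre := congrArg Complex.re h'
  have him := congrArg Complex.im h'
  simp only [← Complex.ofReal_pow, Complex.sub_re, Complex.sub_im, Complex.conj_re, Complex.conj_im,
    Complex.re_ofReal_mul, Complex.im_ofReal_mul, Complex.div_ofReal_re,
    Complex.div_ofReal_im] at hre him
  set s := ‖w‖ with hs
  have hc2 : 0 < c ^ 2 := by positivity
  have hc2' : c ^ 2 < 1 := by nlinarith
  have hs2 : 0 < s ^ 2 := by positivity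
  have hs2' : s ^ 2 < 1 := by nlinarith
  -- semi-axes
  have hx : G.re * (1 - c ^ 2) * s ^ 2 = k * w.re * (1 - c ^ 2 * s ^ 2) := by
    field_simp at hre
    linear_combination hre
  have hy : G.im * (1 + c ^ 2) * s ^ 2 = k * w.im * (1 + c ^ 2 * s ^ 2) := by
    field_simp at him
    linear_combination -him
  -- The map 1/z - c²z sends the circle of radius s to an ellipse with semi-axes 1/s ∓ c²s. Both
  -- exceed their values at s = 1, and the factor k ≥ 1 only moves points further out.
  have key1 : (1 - c ^ 2) * s < 1 - c ^ 2 * s ^ 2 := by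
    nlinarith [mul_pos (sub_pos.2 hw) (by positivity : 0 < 1 + c ^ 2 * s)]
  have key2 : (1 + c ^ 2) * s < 1 + c ^ 2 * s ^ 2 := by nlinarith [mul_pos (sub_pos.2 hw) (sub_pos.2 (mul_lt_one_of_nonneg_of_lt_one_left hc2.le hc2' hw.le))]
  -- Coordinatewise this gives |y| ≤ s|x|, strictly unless y = 0; summing squares would give |w|² <
  -- s²|G|² = s².
  have aux : ∀ {A B x y : ℝ}, 0 < A → A * s < B → x * A * s ^ 2 = k * y * B → y ^ 2 ≤ s ^ 2 * x ^ 2 ∧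
      (y ≠ 0 → y ^ 2 < s ^ 2 * x ^ 2) := by
    intro A B x y hA hB hxy
    have hAs : 0 < A * s := by positivity
    have hkB : A * s < k * B := hB.trans_le (le_mul_of_one_le_left (hAs.trans hB).le hk)
    have e : (x * s) * (A * s) = y * (k * B) := by linear_combination hxy
    have e' : (x * s) ^ 2 * (A * s) ^ 2 = y ^ 2 * (k * B) ^ 2 := by
      rw [← mul_pow, ← mul_pow, e]
    have hsq : (A * s) ^ 2 < (k * B) ^ 2 := by gcongr
    have hp : 0 < (A * s) ^ 2 := by positivity
    constructor
    · refine le_of_mul_le_mul_right ?_ hp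
      rw [← mul_pow s x, mul_comm s x, e']
      exact mul_le_mul_of_nonneg_left hsq.le (sq_nonneg y)
    · intro hy0
      refine lt_of_mul_lt_mul_right ?_ hp.le
      rw [← mul_pow s x, mul_comm s x, e']
      exact mul_lt_mul_of_pos_left hsq (by positivity)
  have hsum : s ^ 2 * G.re ^ 2 + s ^ 2 * G.im ^ 2 = s ^ 2 := by rw [← mul_add, hG2, mul_one]
  obtain ⟨a1, a2⟩ := aux (by linarith) key1 hx
  obtain ⟨b1, b2⟩ := aux (by linarith) key2 hy
  by_cases hr : w.re = 0
  · have hi : w.im ≠ 0 := fun hi => hw0 (Complex.ext hr hi)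
    linarith [b2 hi]
  · linarith [a2 hr]

/-- **Jack's lemma.** -/
theorem exists_one_le_mul_deriv_eq {G : ℂ → ℂ} {z₀ : ℂ} (hz₀ : z₀ ≠ 0)
    (hd : DifferentiableOn ℂ G (ball 0 ‖z₀‖)) (hd₀ : DifferentiableAt ℂ G z₀) (h0 : G 0 = 0)
    (hG₀ : G z₀ ≠ 0) (hmax : ∀ z, ‖z‖ ≤ ‖z₀‖ → ‖G z‖ ≤ ‖G z₀‖) :
    ∃ k : ℝ, 1 ≤ k ∧ z₀ * deriv G z₀ = k * G z₀ := by
  have hn : 0 < ‖z₀‖ := norm_pos_iff.2 hz₀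
  have hGn : 0 < ‖G z₀‖ := norm_pos_iff.2 hG₀
  set q : ℂ := (starRingEnd ℂ) (G z₀) * (z₀ * deriv G z₀) with hq
  -- On the circle through z₀, |G|² is maximal at z₀, so its angular derivative, -2 Im q, vanishes.
  have him : q.im = 0 := by
    have hγ : HasDerivAt (fun θ : ℝ => z₀ * exp (θ * I)) (z₀ * I) 0 := by
      have h1 : HasDerivAt (fun θ : ℝ => (θ : ℂ) * I) I 0 := by
        simpa using (Complex.ofRealCLM.hasDerivAt (x := 0)).mul_const I
      simpa using h1.cexp.const_mul z₀
    have hc : HasDerivAt (fun θ : ℝ => G (z₀ * exp (θ * I))) (deriv G z₀ * (z₀ * I)) 0 := by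
      have h2 : HasDerivAt G (deriv G z₀) (z₀ * exp (((0 : ℝ) : ℂ) * I)) := by
        simpa using hd₀.hasDerivAt
      exact h2.comp (0 : ℝ) hγ
    have hl : IsLocalMax (fun θ : ℝ => ‖G (z₀ * exp (θ * I))‖ ^ 2) 0 := by
      refine Filter.Eventually.of_forall fun θ => ?_
      have : ‖G (z₀ * exp (θ * I))‖ ≤ ‖G z₀‖ := hmax _ (by simp [Complex.norm_exp_ofReal_mul_I])
      simpa using pow_le_pow_left₀ (norm_nonneg _) this 2
    have h3 := hl.hasDerivAt_eq_zero hc.norm_sq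
    have h4 : deriv G z₀ * (z₀ * I) * (starRingEnd ℂ) (G z₀) = q * I := by rw [hq]; ring
    simp only [Complex.ofReal_zero, zero_mul, Complex.exp_zero, mul_one, Complex.inner, h4,
      Complex.mul_I_re] at h3
    linarith
  -- By the Schwarz lemma |G(tz₀)| ≤ t|G(z₀)| on [0, 1], with equality at t = 1. The difference of
  -- squares is thus maximal at the right endpoint, where its derivative is nonnegative.
  have hre : ‖G z₀‖ ^ 2 ≤ q.re := by
    have hγ : HasDerivAt (fun t : ℝ => (t : ℂ) * z₀) z₀ 1 := by
      simpa using (Complex.ofRealCLM.hasDerivAt (x := 1)).mul_const z₀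
    have hc : HasDerivAt (fun t : ℝ => G (t * z₀)) (deriv G z₀ * z₀) 1 := by
      have h2 : HasDerivAt G (deriv G z₀) (((1 : ℝ) : ℂ) * z₀) := by
        simpa using hd₀.hasDerivAt
      exact h2.comp (1 : ℝ) hγ
    have hp : HasDerivAt (fun t : ℝ => ‖G (t * z₀)‖ ^ 2 - t ^ 2 * ‖G z₀‖ ^ 2)
        (2 * q.re - 2 * ‖G z₀‖ ^ 2) 1 := by
      have h4 : deriv G z₀ * z₀ * (starRingEnd ℂ) (G z₀) = q := by rw [hq]; ring
      have := hc.norm_sq.sub (((hasDerivAt_id (1 : ℝ)).pow 2).mul_const (‖G z₀‖ ^ 2))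
      simp only [Complex.inner, Complex.ofReal_one, one_mul, h4] at this
      refine this.congr_deriv ?_
      simp
    have hl : IsLocalMaxOn (fun t : ℝ => ‖G (t * z₀)‖ ^ 2 - t ^ 2 * ‖G z₀‖ ^ 2) (Icc 0 1) 1 := by
      filter_upwards [self_mem_nhdsWithin] with t ht
      have hle : ‖G (t * z₀)‖ ≤ t * ‖G z₀‖ := by
        rcases ht.2.lt_or_eq with h1 | rfl
        · have hb : (t : ℂ) * z₀ ∈ ball (0 : ℂ) ‖z₀‖ := by
            rw [mem_ball_zero_iff, norm_mul, Complex.norm_of_nonneg ht.1]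
            nlinarith
          have hm : MapsTo G (ball 0 ‖z₀‖) (closedBall (G 0) ‖G z₀‖) := by
            intro z hz
            rw [h0, mem_closedBall_zero_iff]
            exact hmax z (mem_ball_zero_iff.1 hz).le
          have := Complex.dist_le_div_mul_dist_of_mapsTo_ball hd hm hb
          rw [h0, dist_zero_right, dist_zero_right, norm_mul, Complex.norm_of_nonneg ht.1] at this
          calc _ ≤ _ := this
            _ = _ := by field_simp
        · simp
      have := pow_le_pow_left₀ (norm_nonneg _) hle 2
      simp only [Complex.ofReal_one, one_mul, one_pow, sub_self]
      rw [mul_pow] at this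
      linarith
    have h5 := hl.hasFDerivWithinAt_nonpos hp.hasFDerivAt.hasFDerivWithinAt
      (y := -1) (mem_posTangentConeAt_of_segment_subset (by
        rw [segment_symm, segment_eq_Icc (by norm_num)]; norm_num))
    simp at h5
    linarith
  have hG2 : 0 < ‖G z₀‖ ^ 2 := by positivity
  refine ⟨q.re / ‖G z₀‖ ^ 2, (one_le_div hG2).2 hre, ?_⟩
  have hqr : q = (q.re : ℂ) := Complex.ext (by simp) (by simpa using him)
  have hG2' : (‖G z₀‖ : ℂ) ≠ 0 := by exact_mod_cast hGn.ne'
  push_cast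
  rw [← hqr, hq, div_mul_eq_mul_div, eq_div_iff (pow_ne_zero 2 hG2'), ← Complex.mul_conj']
  ring

/-! ### Subordination to artanh(cz)/c and the bound on Im g -/

/-- If `sinh w / cosh w` has modulus at most `√a ≤ 1`, so has `tan (Im w)`. -/
theorem sin_sq_im_le {a : ℝ} (ha : a ≤ 1) {w : ℂ}
    (h : ‖sinh w‖ ^ 2 ≤ a * ‖cosh w‖ ^ 2) :
    Real.sin w.im ^ 2 ≤ a * Real.cos w.im ^ 2 := by
  have hs : ‖sinh w‖ ^ 2 = Real.sinh w.re ^ 2 + Real.sin w.im ^ 2 := by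
    rw [Complex.sq_norm, Complex.normSq_apply]
    conv_lhs => rw [← Complex.re_add_im w, Complex.sinh_add, Complex.sinh_mul_I, Complex.cosh_mul_I,
      ← Complex.ofReal_sinh, ← Complex.ofReal_cosh, ← Complex.ofReal_sin, ← Complex.ofReal_cos]
    simp only [Complex.add_re, Complex.add_im, Complex.mul_re, Complex.mul_im, Complex.ofReal_re,
      Complex.ofReal_im, Complex.I_re, Complex.I_im]
    linear_combination (Real.sin w.im ^ 2) * Real.cosh_sq w.re + (Real.sinh w.re) ^ 2 * Real.sin_sq_add_cos_sq w.im
  have hc : ‖cosh w‖ ^ 2 = Real.sinh w.re ^ 2 + Real.cos w.im ^ 2 := by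
    rw [Complex.sq_norm, Complex.normSq_apply]
    conv_lhs => rw [← Complex.re_add_im w, Complex.cosh_add, Complex.sinh_mul_I, Complex.cosh_mul_I,
      ← Complex.ofReal_sinh, ← Complex.ofReal_cosh, ← Complex.ofReal_sin, ← Complex.ofReal_cos]
    simp only [Complex.add_re, Complex.add_im, Complex.mul_re, Complex.mul_im, Complex.ofReal_re,
      Complex.ofReal_im, Complex.I_re, Complex.I_im]
    linear_combination (Real.cos w.im ^ 2) * Real.cosh_sq w.re + (Real.sinh w.re) ^ 2 * Real.sin_sq_add_cos_sq w.im
  rw [hs, hc] at h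
  nlinarith [mul_nonneg (sub_nonneg.2 ha) (sq_nonneg (Real.sinh w.re))]

/-- A solution of `z g'(z) = w / (1 - c² w²)`, with `w` a Schwarz function, is subordinate to
`artanh (c z) / c`; here in the form `|tanh (c g)| < c`. -/
theorem norm_sinh_lt {c : ℝ} (hc0 : 0 < c) (hc1 : c < 1) {g ω : ℂ → ℂ}
    (hg : DifferentiableOn ℂ g (ball 0 1)) (hg0 : g 0 = 0) (hω : MapsTo ω (ball 0 1) (ball 0 1))
    (hgω : ∀ z ∈ ball (0 : ℂ) 1, z * deriv g z = ω z / (1 - (c : ℂ) ^ 2 * ω z ^ 2))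
    {z : ℂ} (hz : z ∈ ball (0 : ℂ) 1) : ‖sinh (c * g z)‖ < c * ‖cosh (c * g z)‖ := by
  by_contra! hcon
  have hz1 : ‖z‖ < 1 := mem_ball_zero_iff.1 hz
  have hsub : closedBall (0 : ℂ) ‖z‖ ⊆ ball 0 1 := closedBall_subset_ball hz1
  have hcg : ContinuousOn (fun z => (c : ℂ) * g z) (ball 0 1) := hg.continuousOn.const_smul (c : ℂ)
  have hcs : ContinuousOn (fun z => ‖sinh (c * g z)‖) (ball 0 1) :=
    (Complex.continuous_sinh.comp_continuousOn hcg).norm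
  have hcc : ContinuousOn (fun z => c * ‖cosh (c * g z)‖) (ball 0 1) :=
    (Complex.continuous_cosh.comp_continuousOn hcg).norm.const_smul c
  -- a point of least modulus at which the inequality fails
  have hcomp : IsCompact {u ∈ closedBall (0 : ℂ) ‖z‖ | c * ‖cosh (c * g u)‖ ≤ ‖sinh (c * g u)‖} := by
    refine (isCompact_closedBall (0 : ℂ) ‖z‖).of_isClosed_subset ?_ (sep_subset _ _)
    exact isClosed_closedBall.isClosed_le (hcc.mono hsub) (hcs.mono hsub)
  obtain ⟨z₀, ⟨hz₀z, hz₀⟩, hmin⟩ := hcomp.exists_isMinOn ⟨z, by simp, hcon⟩ continuous_norm.continuousOn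
  have hz₀z' : ‖z₀‖ ≤ ‖z‖ := mem_closedBall_zero_iff.1 hz₀z
  have hz₀b : z₀ ∈ ball (0 : ℂ) 1 := hsub hz₀z
  have hlt : ∀ u, ‖u‖ < ‖z₀‖ → ‖sinh (c * g u)‖ < c * ‖cosh (c * g u)‖ := by
    intro u hu
    by_contra! h
    have : ‖z₀‖ ≤ ‖u‖ := hmin ⟨mem_closedBall_zero_iff.2 (hu.le.trans hz₀z'), h⟩
    exact this.not_gt hu
  have hz₀0 : z₀ ≠ 0 := by
    rintro rfl
    simp [hg0] at hz₀
    linarith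
  have hle : ∀ u, ‖u‖ ≤ ‖z₀‖ → ‖sinh (c * g u)‖ ≤ c * ‖cosh (c * g u)‖ := by
    have hcl : closure (ball (0 : ℂ) ‖z₀‖) = closedBall 0 ‖z₀‖ :=
      closure_ball _ (norm_ne_zero_iff.2 hz₀0)
    have hs' : closure (ball (0 : ℂ) ‖z₀‖) ⊆ ball 0 1 := by
      rw [hcl]; exact closedBall_subset_ball (hz₀z'.trans_lt hz1)
    intro u hu
    refine le_on_closure (s := ball (0 : ℂ) ‖z₀‖) (fun v hv => (hlt v (mem_ball_zero_iff.1 hv)).le)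
      (hcs.mono hs') (hcc.mono hs') ?_
    rw [hcl]; exact mem_closedBall_zero_iff.2 hu
  -- A zero of cosh would by `hle` be a zero of sinh, against cosh² - sinh² = 1.
  have hcosh : ∀ u, ‖u‖ ≤ ‖z₀‖ → cosh (c * g u) ≠ 0 := by
    intro u hu h
    have h1 := hle u hu
    rw [h, norm_zero, mul_zero, norm_le_zero_iff] at h1
    have := Complex.cosh_sq_sub_sinh_sq (c * g u)
    simp [h, h1] at this
  have hc' : (c : ℂ) ≠ 0 := by exact_mod_cast hc0.ne'
  set G : ℂ → ℂ := fun u => sinh (c * g u) / (c * cosh (c * g u)) with hGdef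
  have hnG : ∀ u, ‖G u‖ = ‖sinh (c * g u)‖ / (c * ‖cosh (c * g u)‖) := fun u => by
    rw [hGdef]; simp [abs_of_pos hc0]
  have hpos : ∀ u, ‖u‖ ≤ ‖z₀‖ → 0 < c * ‖cosh (c * g u)‖ := fun u hu =>
    mul_pos hc0 (norm_pos_iff.2 (hcosh u hu))
  have hderiv : ∀ u, ‖u‖ ≤ ‖z₀‖ → HasDerivAt G (deriv g u / cosh (c * g u) ^ 2) u := by
    intro u hu
    have hub : u ∈ ball (0 : ℂ) 1 := mem_ball_zero_iff.2 (hu.trans_lt (hz₀z'.trans_lt hz1))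
    have hgu : HasDerivAt (fun u => (c : ℂ) * g u) (c * deriv g u) u :=
      ((hg.differentiableAt (isOpen_ball.mem_nhds hub)).hasDerivAt).const_mul _
    have := hgu.csinh.div (hgu.ccosh.const_mul (c : ℂ)) (mul_ne_zero hc' (hcosh u hu))
    refine this.congr_deriv ?_
    have h1 := hcosh u hu
    have h2 := Complex.cosh_sq_sub_sinh_sq (c * g u)
    field_simp
    linear_combination (deriv g u) * h2
  have hG1 : ‖G z₀‖ = 1 := by
    rw [hnG, div_eq_one_iff_eq (hpos z₀ le_rfl).ne']
    exact (hle z₀ le_rfl).antisymm hz₀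
  obtain ⟨k, hk, hkG⟩ := exists_one_le_mul_deriv_eq hz₀0
    (fun u hu => (hderiv u (mem_ball_zero_iff.1 hu).le).differentiableAt.differentiableWithinAt)
    (hderiv z₀ le_rfl).differentiableAt (by simp [hGdef, hg0])
    (norm_ne_zero_iff.1 (by rw [hG1]; exact one_ne_zero))
    (fun u hu => by rw [hG1, hnG]; exact (div_le_one (hpos u hu)).2 (hle u hu))
  have hω1 : ‖ω z₀‖ < 1 := mem_ball_zero_iff.1 (hω hz₀b)
  have hden : 1 - (c : ℂ) ^ 2 * ω z₀ ^ 2 ≠ 0 := by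
    intro h
    have h1 : ‖(c : ℂ) ^ 2 * ω z₀ ^ 2‖ = 1 := by rw [← sub_eq_zero.1 h, norm_one]
    rw [← mul_pow, norm_pow, norm_mul, Complex.norm_of_nonneg hc0.le] at h1
    have h2 : c * ‖ω z₀‖ < 1 := mul_lt_one_of_nonneg_of_lt_one_left hc0.le hc1 hω1.le
    have h3 : (c * ‖ω z₀‖) ^ 2 < 1 := pow_lt_one₀ (by positivity) h2 two_ne_zero
    linarith
  refine booth_starlike hc0 hc1 hk hG1 hω1 ?_
  have h1 := hcosh z₀ le_rfl
  have h2 := Complex.cosh_sq_sub_sinh_sq (c * g z₀)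
  -- This turns G' = g'/cosh² into z₀g'(z₀) = kG/(1 - c²G²), a multiple of a Booth value.
  have h3 : 1 - (c : ℂ) ^ 2 * G z₀ ^ 2 = 1 / cosh (c * g z₀) ^ 2 := by
    simp only [hGdef]
    field_simp
    linear_combination h2
  rw [(hderiv z₀ le_rfl).deriv, mul_div_assoc', hgω z₀ hz₀b] at hkG
  rw [h3, ← hkG, mul_one_div, div_right_comm, div_mul_cancel₀ _ hden]

/-- Under the hypotheses of `norm_sinh_lt`, `|tanh (c g z)| ≤ c |z|`. -/
theorem norm_sinh_le {c : ℝ} (hc0 : 0 < c) (hc1 : c < 1) {g ω : ℂ → ℂ}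
    (hg : DifferentiableOn ℂ g (ball 0 1)) (hg0 : g 0 = 0) (hω : MapsTo ω (ball 0 1) (ball 0 1))
    (hgω : ∀ z ∈ ball (0 : ℂ) 1, z * deriv g z = ω z / (1 - (c : ℂ) ^ 2 * ω z ^ 2))
    {z : ℂ} (hz : z ∈ ball (0 : ℂ) 1) : ‖sinh (c * g z)‖ ≤ c * ‖z‖ * ‖cosh (c * g z)‖ := by
  have hlt := fun u hu => norm_sinh_lt hc0 hc1 hg hg0 hω hgω (z := u) hu
  have hpos : ∀ u ∈ ball (0 : ℂ) 1, 0 < ‖cosh (c * g u)‖ := fun u hu => by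
    have := (norm_nonneg _).trans_lt (hlt u hu)
    exact pos_of_mul_pos_right this hc0.le
  have hd : DifferentiableOn ℂ (fun u => sinh (c * g u) / cosh (c * g u)) (ball 0 1) :=
    (hg.const_mul (c : ℂ)).csinh.div (hg.const_mul (c : ℂ)).ccosh
      fun u hu => norm_pos_iff.1 (hpos u hu)
  have hm : MapsTo (fun u => sinh (c * g u) / cosh (c * g u)) (ball 0 1)
      (closedBall (sinh (c * g 0) / cosh (c * g 0)) c) := by
    intro u hu
    simp only [hg0, mul_zero, Complex.sinh_zero, zero_div, mem_closedBall_zero_iff, norm_div]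
    rw [div_le_iff₀ (hpos u hu)]
    exact (hlt u hu).le
  have := Complex.dist_le_div_mul_dist_of_mapsTo_ball hd hm hz
  simp only [hg0, mul_zero, Complex.sinh_zero, zero_div, dist_zero_right, norm_div, div_one] at this
  rwa [div_le_iff₀ (hpos z hz)] at this

/-- The bound on tan(c Im g) determines c Im g only modulo π. The branch is fixed by connectedness:
cos(c Im g) has no zero in the disk and c Im g vanishes at 0, so c Im g stays in (-π/2, π/2). -/
theorem abs_im_le_arctan {c : ℝ} (hc0 : 0 < c) (hc1 : c < 1) {g ω : ℂ → ℂ}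
    (hg : DifferentiableOn ℂ g (ball 0 1)) (hg0 : g 0 = 0) (hω : MapsTo ω (ball 0 1) (ball 0 1))
    (hgω : ∀ z ∈ ball (0 : ℂ) 1, z * deriv g z = ω z / (1 - (c : ℂ) ^ 2 * ω z ^ 2))
    {z : ℂ} (hz : z ∈ ball (0 : ℂ) 1) : |(g z).im| ≤ Real.arctan (c * ‖z‖) / c := by
  have hsin : ∀ u ∈ ball (0 : ℂ) 1,
      Real.sin (c * (g u).im) ^ 2 ≤ (c * ‖u‖) ^ 2 * Real.cos (c * (g u).im) ^ 2 := by
    intro u hu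
    have hu1 : ‖u‖ < 1 := mem_ball_zero_iff.1 hu
    have h1 : (c * ‖u‖) ^ 2 ≤ 1 := pow_le_one₀ (by positivity)
      (mul_le_one₀ hc1.le (norm_nonneg _) hu1.le)
    have h2 := pow_le_pow_left₀ (norm_nonneg _) (norm_sinh_le hc0 hc1 hg hg0 hω hgω hu) 2
    rw [mul_pow] at h2
    simpa [Complex.im_ofReal_mul] using sin_sq_im_le h1 h2
  have hcos : ∀ u ∈ ball (0 : ℂ) 1, Real.cos (c * (g u).im) ≠ 0 := by
    intro u hu h
    have h1 := hsin u hu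
    have h2 := Real.sin_sq_add_cos_sq (c * (g u).im)
    rw [h] at h1 h2
    norm_num at h1 h2
    norm_num [h1] at h2
  have hcont : ContinuousOn (fun u => c * (g u).im) (ball 0 1) :=
    (Complex.continuous_im.comp_continuousOn hg.continuousOn).const_smul c
  have hconn : IsPreconnected (ball (0 : ℂ) 1) := (convex_ball 0 1).isPreconnected
  have h0 : (0 : ℂ) ∈ ball (0 : ℂ) 1 := mem_ball_self one_pos
  have hv1 : c * (g z).im < Real.pi / 2 := by
    by_contra! h
    obtain ⟨u, hu, hu'⟩ := hconn.intermediate_value h0 hz hcont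
      ⟨by simp [hg0]; positivity, h⟩
    exact hcos u hu (by simp only at hu'; rw [hu', Real.cos_pi_div_two])
  have hv2 : -(Real.pi / 2) < c * (g z).im := by
    by_contra! h
    obtain ⟨u, hu, hu'⟩ := hconn.intermediate_value hz h0 hcont
      ⟨h, by simp [hg0]; positivity⟩
    exact hcos u hu (by simp only at hu'; rw [hu', Real.cos_neg, Real.cos_pi_div_two])
  have hcp : 0 < Real.cos (c * (g z).im) := Real.cos_pos_of_mem_Ioo ⟨hv2, hv1⟩
  have htan : |Real.tan (c * (g z).im)| ≤ c * ‖z‖ := by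
    refine abs_le_of_sq_le_sq ?_ (by positivity)
    rw [Real.tan_eq_sin_div_cos, div_pow, div_le_iff₀ (by positivity)]
    exact hsin z hz
  obtain ⟨t1, t2⟩ := abs_le.1 htan
  have e := Real.arctan_tan hv2 hv1
  have u1 := Real.arctan_mono t1
  have u2 := Real.arctan_mono t2
  rw [Real.arctan_neg] at u1
  rw [e] at u1 u2
  rw [le_div_iff₀ hc0, ← abs_of_pos hc0, ← abs_mul, abs_of_pos hc0, mul_comm (g z).im]
  exact abs_le.2 ⟨u1, u2⟩

/-! ### The logarithm of f(z)/z -/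

/-- A zero-free-off-origin function of class `𝒜` is `z exp (g z)`, where
`z g'(z) = z f'(z) / f(z) - 1`. -/
theorem exists_eq_mul_exp {f : ℂ → ℂ} (hf : f ∈ classA)
    (hf0 : ∀ z ∈ ball (0 : ℂ) 1, z ≠ 0 → f z ≠ 0) :
    ∃ g : ℂ → ℂ, DifferentiableOn ℂ g (ball 0 1) ∧ g 0 = 0 ∧
      (∀ z ∈ ball (0 : ℂ) 1, z * deriv g z = starQuotient f z) ∧
      ∀ z ∈ ball (0 : ℂ) 1, f z = z * exp (g z) := by
  obtain ⟨hfa, hf00, hf1⟩ := hf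
  set P := dslope f 0 with hP
  have hfP : ∀ z, f z = z * P z := fun z => by
    have := sub_smul_dslope f 0 z
    simp only [sub_zero, hf00, smul_eq_mul] at this
    exact this.symm
  have h0 : (0 : ℂ) ∈ ball (0 : ℂ) 1 := mem_ball_self one_pos
  have hPd : DifferentiableOn ℂ P (ball 0 1) :=
    (Complex.differentiableOn_dslope (isOpen_ball.mem_nhds h0)).2 hfa.differentiableOn
  have hP0 : P 0 = 1 := by rw [hP, dslope_same, hf1]
  have hPne : ∀ z ∈ ball (0 : ℂ) 1, P z ≠ 0 := by
    intro z hz h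
    by_cases hz0 : z = 0
    · rw [hz0, hP0] at h; exact one_ne_zero h
    · exact hf0 z hz hz0 (by rw [hfP, h, mul_zero])
  have hPat : ∀ z ∈ ball (0 : ℂ) 1, HasDerivAt P (deriv P z) z := fun z hz =>
    (hPd.differentiableAt (isOpen_ball.mem_nhds hz)).hasDerivAt
  -- g is the primitive of P'/P on the disk with g(0) = 0, where P is f(z)/z with the singularity
  -- removed.
  obtain ⟨g, hg0, hg⟩ := (((hPd.deriv isOpen_ball).div hPd hPne).isExactOn_ball).with_val_at 0 0
  have hgd : DifferentiableOn ℂ g (ball 0 1) := fun z hz =>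
    (hg z hz).differentiableAt.differentiableWithinAt
  refine ⟨g, hgd, hg0, fun z hz => ?_, fun z hz => ?_⟩
  · rw [(hg z hz).deriv, starQuotient]
    split_ifs with hz0
    · simp [hz0]
    · have h1 : deriv f z = P z + z * deriv P z := by
        have : f = fun z => z * P z := funext hfP
        rw [this]
        exact ((hasDerivAt_id z).mul (hPat z hz)).deriv.trans (by simp)
      have h2 := hPne z hz
      rw [h1, hfP z, Pi.div_apply]
      field_simp
      ring
  · have hcst : P z * exp (-g z) = P 0 * exp (-g 0) := by
      refine isOpen_ball.is_const_of_deriv_eq_zero (f := fun z => P z * exp (-g z))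
        (convex_ball (0 : ℂ) 1).isPreconnected (hPd.mul hgd.neg.cexp) (fun u hu => ?_) hz h0
      have := ((hPat u hu).mul (hg u hu).neg.cexp).deriv
      have h2 := hPne u hu
      refine this.trans ?_
      simp only [Pi.zero_apply, Pi.div_apply, Pi.neg_apply]
      field_simp
      ring
    rw [hP0, hg0, neg_zero, Complex.exp_zero, mul_one, Complex.exp_neg,
      mul_inv_eq_one₀ (Complex.exp_ne_zero _)] at hcst
    rw [hfP, hcst]

theorem arctan_le_self {x : ℝ} (hx : 0 ≤ x) : Real.arctan x ≤ x := by
  have := Real.le_tan (Real.arctan_nonneg.2 hx) (Real.arctan_lt_pi_div_two x)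
  rwa [Real.tan_arctan] at this

/-- Since arctan(x) ≤ x, the bound on |Im g| is at most |z| < π, so Im g is the principal argument
of exp(g). -/
theorem abs_arg_div_le {α : ℝ} (hα : 0 < α) (hα1 : α < 1) {f : ℂ → ℂ} (hf : f ∈ classBS α) {z : ℂ}
    (hz : z ≠ 0) (hz1 : ‖z‖ < 1) :
    |arg (f z / z)| ≤ Real.arctan (√α * ‖z‖) / √α := by
  obtain ⟨hfA, hf0, ω, ⟨-, -, hω⟩, hfω⟩ := hf
  obtain ⟨g, hg, hg0, hgs, hfg⟩ := exists_eq_mul_exp hfA hf0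
  have hc0 : 0 < √α := Real.sqrt_pos.2 hα
  have hc1 : √α < 1 := by rw [Real.sqrt_lt' one_pos]; simpa using hα1
  have hzb : z ∈ ball (0 : ℂ) 1 := mem_ball_zero_iff.2 hz1
  have hbd : |(g z).im| ≤ Real.arctan (√α * ‖z‖) / √α := by
    refine abs_im_le_arctan hc0 hc1 hg hg0 hω (fun u hu => ?_) hzb
    rw [hgs u hu, hfω u hu, booth, ← Complex.ofReal_pow, Real.sq_sqrt hα.le]
  have hlt : |(g z).im| < Real.pi := by
    have h1 : Real.arctan (√α * ‖z‖) / √α ≤ ‖z‖ := by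
      rw [div_le_iff₀ hc0, mul_comm ‖z‖]
      exact arctan_le_self (by positivity)
    linarith [Real.pi_gt_three]
  rw [hfg z hzb, mul_div_cancel_left₀ _ hz, Complex.arg_exp,
    toIocMod_eq_self _ |>.2]
  · exact hbd
  · have := abs_lt.1 hlt
    exact ⟨this.1, by linarith⟩

/-! ### The extremal function -/

theorem boothPower_of_ne_zero {α : ℝ} {z : ℂ} (h : 1 + z * (√α : ℂ) ≠ 0) (h' : 1 - z * (√α : ℂ) ≠ 0) :
    boothPower α z =
      exp (log ((1 + z * (√α : ℂ)) / (1 - z * (√α : ℂ))) * (1 / (2 * √α) : ℝ)) := by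
  rw [boothPower, Complex.cpow_def_of_ne_zero (div_ne_zero h h')]

theorem hasDerivAt_boothPower {α : ℝ} (hα : 0 < α) (hα1 : α < 1) {z : ℂ}
    (hz : z ∈ ball (0 : ℂ) 1) :
    boothPower α z ≠ 0 ∧ HasDerivAt (boothPower α) (boothPower α z / (1 - α * z ^ 2)) z := by
  have hc0 : 0 < √α := Real.sqrt_pos.2 hα
  have hc1 : √α < 1 := by rw [Real.sqrt_lt' one_pos]; simpa using hα1
  have hαc : (α : ℂ) = (√α : ℂ) ^ 2 := by rw [← Complex.ofReal_pow, Real.sq_sqrt hα.le]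
  set c := √α with hc
  set w : ℂ := z * (c : ℂ) with hw
  have hw1 : ‖w‖ < 1 := by
    rw [hw, norm_mul, Complex.norm_of_nonneg hc0.le]
    exact mul_lt_one_of_nonneg_of_lt_one_left (norm_nonneg _) (mem_ball_zero_iff.1 hz) hc1.le
  have hne : 1 + w ≠ 0 := fun h => by
    have : ‖w‖ = 1 := by rw [eq_neg_of_add_eq_zero_right h, norm_neg, norm_one]
    linarith
  have hne' : 1 - w ≠ 0 := fun h => by
    have : ‖w‖ = 1 := by rw [← sub_eq_zero.1 h, norm_one]
    linarith
  have hc' : (c : ℂ) ≠ 0 := by exact_mod_cast hc0.ne'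
  -- The real part is (1 - |w|²)/|1 - w|² > 0.
  have hslit : (1 + w) / (1 - w) ∈ slitPlane := by
    left
    have h1 : (1 + w) / (1 - w) = (1 + w) * (starRingEnd ℂ) (1 - w) / ((‖1 - w‖ ^ 2 : ℝ) : ℂ) := by
      have : (starRingEnd ℂ) (1 - w) ≠ 0 := by rwa [Ne, map_eq_zero]
      rw [Complex.ofReal_pow, ← Complex.mul_conj']
      field_simp
    rw [h1, Complex.div_ofReal_re]
    refine div_pos ?_ (by have := norm_pos_iff.2 hne'; positivity)
    have h2 : ‖w‖ ^ 2 < 1 := pow_lt_one₀ (norm_nonneg _) hw1 two_ne_zero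
    rw [Complex.sq_norm, Complex.normSq_apply] at h2
    simp
    linarith
  have hq : HasDerivAt (fun u : ℂ => (1 + u * (c : ℂ)) / (1 - u * (c : ℂ)))
      (2 * c / (1 - w) ^ 2) z := by
    have h1 : HasDerivAt (fun u : ℂ => u * (c : ℂ)) c z := hasDerivAt_mul_const _
    refine ((h1.const_add 1).div (h1.const_sub 1) hne').congr_deriv ?_
    rw [← hw]
    congr 1
    ring
  refine ⟨?_, ?_⟩
  · rw [boothPower_of_ne_zero hne hne']
    exact Complex.exp_ne_zero _
  · refine (hq.cpow_const hslit (c := (((1 / (2 * c) : ℝ)) : ℂ))).congr_deriv ?_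
    rw [← hw, Complex.cpow_sub _ _ (div_ne_zero hne hne'), Complex.cpow_one, boothPower, ← hc, ← hw]
    have h3 : 1 - (α : ℂ) * z ^ 2 = (1 + w) * (1 - w) := by rw [hαc, hw]; ring
    rw [h3]
    push_cast
    field_simp

theorem fHat_mem_classBS {α : ℝ} (hα : 0 < α) (hα1 : α < 1) : fHat α ∈ classBS α := by
  have hd : ∀ z ∈ ball (0 : ℂ) 1, HasDerivAt (fHat α)
      (boothPower α z + z * (boothPower α z / (1 - α * z ^ 2))) z := fun z hz => by
    exact ((hasDerivAt_id z).mul (hasDerivAt_boothPower hα hα1 hz).2).congr_deriv (by simp)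
  have h0 : (0 : ℂ) ∈ ball (0 : ℂ) 1 := mem_ball_self one_pos
  refine ⟨⟨?_, by simp [fHat], ?_⟩, fun z hz hz0 => ?_, id,
    ⟨fun z _ => analyticAt_id, rfl, mapsTo_id _⟩, fun z hz => ?_⟩
  · exact DifferentiableOn.analyticOnNhd
      (fun z hz => (hd z hz).differentiableAt.differentiableWithinAt) isOpen_ball
  · rw [(hd 0 h0).deriv]
    simp [boothPower]
  · exact mul_ne_zero hz0 (hasDerivAt_boothPower hα hα1 hz).1
  · rw [starQuotient, booth, id]
    split_ifs with hz0
    · simp [hz0]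
    · rw [(hd z hz).deriv, fHat]
      have h1 := (hasDerivAt_boothPower hα hα1 hz).1
      field_simp
      ring

/-- At z = ir the base is a quotient of conjugates, exp(2it) with t = arctan(cr), so the power is
exp(it/c); no wrapping occurs because t/c ≤ r < π. -/
theorem arg_boothPower_mul_I {α r : ℝ} (hα : 0 < α) (hr : 0 < r) (hr1 : r < 1) :
    arg (boothPower α (r * I)) = Real.arctan (√α * r) / √α := by
  have hc0 : 0 < √α := Real.sqrt_pos.2 hα
  set c := √α with hc
  set t := Real.arctan (c * r) with ht
  have ht0 : 0 < t := Real.arctan_pos.2 (by positivity)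
  have ht1 : t < Real.pi / 2 := Real.arctan_lt_pi_div_two _
  have hne : 1 + (r * I) * (c : ℂ) ≠ 0 := fun h => by simpa using congrArg Complex.re h
  have hne' : 1 - (r * I) * (c : ℂ) ≠ 0 := fun h => by simpa using congrArg Complex.re h
  have hcos : 0 < Real.cos t := Real.cos_arctan_pos _
  have hsin : Real.sin t = c * r * Real.cos t := by
    have := Real.tan_arctan (c * r)
    rw [← ht, Real.tan_eq_sin_div_cos, div_eq_iff hcos.ne'] at this
    exact this
  have hlog : log ((1 + (r * I) * (c : ℂ)) / (1 - (r * I) * (c : ℂ))) = ((2 * t : ℝ) : ℂ) * I := by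
    have he : (1 + (r * I) * (c : ℂ)) / (1 - (r * I) * (c : ℂ)) = exp (((2 * t : ℝ) : ℂ) * I) := by
      have hcos' : (Real.cos t : ℂ) ≠ 0 := by exact_mod_cast hcos.ne'
      have e1 : exp (t * I) = Real.cos t * (1 + (r * I) * (c : ℂ)) := by
        rw [Complex.exp_mul_I, ← Complex.ofReal_cos, ← Complex.ofReal_sin, hsin]
        push_cast; ring
      have e2 : exp (-(t * I)) = Real.cos t * (1 - (r * I) * (c : ℂ)) := by
        rw [← neg_mul, ← Complex.ofReal_neg, Complex.exp_mul_I, ← Complex.ofReal_cos,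
          ← Complex.ofReal_sin, Real.cos_neg, Real.sin_neg, hsin]
        push_cast; ring
      have e3 : ((2 * t : ℝ) : ℂ) * I = t * I - -(t * I) := by push_cast; ring
      rw [e3, Complex.exp_sub, e1, e2, mul_div_mul_left _ _ hcos']
    rw [he, Complex.log_exp] <;> simp <;> linarith [Real.pi_pos]
  have hle : t / c ≤ r := by
    rw [div_le_iff₀ hc0, mul_comm r]
    exact arctan_le_self (by positivity)
  have hpos : 0 < t / c := by positivity
  rw [boothPower_of_ne_zero hne hne', ← hc, hlog]
  have : ((2 * t : ℝ) : ℂ) * I * ((1 / (2 * c) : ℝ) : ℂ) = ((t / c : ℝ) : ℂ) * I := by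
    have hc' : (c : ℂ) ≠ 0 := by exact_mod_cast hc0.ne'
    push_cast
    field_simp
  rw [this, Complex.arg_exp_mul_I, toIocMod_eq_self _ |>.2]
  exact ⟨by linarith [Real.pi_pos], by linarith [Real.pi_gt_three]⟩

end GeomFun

theorem mainTheorem10 (α : ℝ) (hα : 0 < α) (hα' : α ≤ 2 - Real.sqrt 3) :
    GeomFun.fHat α ∈ GeomFun.classBS α ∧
      ∀ r : ℝ, 0 < r → r < 1 →
        ∃ M : ℝ,
          IsGreatest ((fun z : ℂ => Complex.arg (GeomFun.boothPower α z)) ''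
            Metric.sphere (0 : ℂ) r) M ∧
          (∀ f ∈ GeomFun.classBS α, ∀ z : ℂ, ‖z‖ = r → |Complex.arg (f z / z)| ≤ M) ∧
          (∃ z : ℂ, ‖z‖ = r ∧ |Complex.arg (GeomFun.fHat α z / z)| = M) := by
  have hα1 : α < 1 := by
    have : 1 < Real.sqrt 3 := by rw [Real.lt_sqrt] <;> norm_num
    linarith
  have hmem := GeomFun.fHat_mem_classBS hα hα1
  refine ⟨hmem, fun r hr hr1 => ⟨Real.arctan (√α * r) / √α, ?_, ?_, ?_⟩⟩
  all_goals
    have hbd : ∀ f ∈ GeomFun.classBS α, ∀ z : ℂ, ‖z‖ = r →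
        |Complex.arg (f z / z)| ≤ Real.arctan (√α * r) / √α := by
      rintro f hf z rfl
      exact GeomFun.abs_arg_div_le hα hα1 hf (norm_pos_iff.1 hr) hr1
    have hdiv : ∀ z : ℂ, ‖z‖ = r → GeomFun.fHat α z / z = GeomFun.boothPower α z := by
      rintro z rfl
      exact mul_div_cancel_left₀ _ (norm_pos_iff.1 hr)
    have hI : ‖(r : ℂ) * Complex.I‖ = r := by simp [abs_of_pos hr]
  · refine ⟨⟨r * Complex.I, mem_sphere_zero_iff_norm.2 hI,
      GeomFun.arg_boothPower_mul_I hα hr hr1⟩, ?_⟩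
    -- The upper bound is the class estimate applied to `fHat` itself.
    rintro _ ⟨z, hz, rfl⟩
    have hz' : ‖z‖ = r := mem_sphere_zero_iff_norm.1 hz
    have := hbd _ hmem z hz'
    rw [hdiv z hz'] at this
    exact (le_abs_self _).trans this
  · exact hbd
  · refine ⟨r * Complex.I, hI, ?_⟩
    rw [hdiv _ hI, GeomFun.arg_boothPower_mul_I hα hr hr1, abs_of_nonneg]
    have := Real.arctan_nonneg.2 (by positivity : 0 ≤ √α * r)
    positivity
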